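/- Let $H_A,H_B,H_E$ be finite-dimensional complex Hilbert spaces, and let $\mathcal N:B(H_A)\to B(H_B)$ be a quantum channel with Stinespring isometry $V:H_A\to H_B\otimes H_E$, i.e. $V^*V=1$ and $\mathcal N(\rho)=\mathrm{tr}_E(V\rho V^*)$. Fix an orthonormal basis $(|e_i\rangle)$ of $H_E$. For $|h\rangle\in H_A$ write $V|h\rangle=\sum_i|h_i\rangle\otimes|e_i\rangle$ and let $h=\sum_i|h_i\rangle\langle e_i|\in B(H_E,H_B)$ be the corresponding operator. Let $X=\{h : |h\rangle\in H_A\}\subseteq B(H_E,H_B)$ be the Stinespring space, and suppose that $\mathcal N$ is a TRO channel, i.e. $xy^*z\in X$ for all $x,y,z\in X$. Put $$\mathcal L(X)=\mathrm{span}\{xy^*: x,y\in X\}\subseteq B(H_B),\qquad \mathcal R(X)=\mathrm{span}\{x^*y: x,y\in X\}\subseteq B(H_E).$$ Let $\tau=\mathrm{tr}/\dim H_E$ be the normalized trace on $B(H_E)$, and let $f\in B(H_E)$ be a symbol of $\mathcal N$: $f\ge 0$, $\tau(f)=1$, and $f$ is strongly independent of $\mathcal R(X)$, i.e. $\tau(f^ny)=\tau(f^n)\tau(y)$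 for all $n\in\mathbb N$ and $y\in\mathcal R(X)$. Let $\mathcal N_f:B(H_A)\to B(H_B)$ be the linear map with $\mathcal N_f(|h\rangle\langle k|)=hfk^*$ for all $|h\rangle,|k\rangle\in H_A$. Let $1\le p\le\infty$ and $\frac1p+\frac1{p'}=1$. Write $\|a\|_p=\mathrm{tr}(|a|^p)^{1/p}$ and $\|f\|_{p,\tau}=\tau(|f|^p)^{1/p}$, both read as the operator norm for $p=\infty$. For positive $\sigma$, the power $\sigma^{-1/2p'}$ is formed with the inverse taken on the support of $\sigma$ (it vanishes on $\ker\sigma$; for $p=1$ it is the support projection of $\sigma$). **Theorem 2.4 (local comparison property).** For all positive operators $\sigma\in\mathcal L(X)$ and $\rho\in B(H_A)$: i) $\ \|\mathcal N(\rho)\|_p\le\|\mathcal N_f(\rho)\|_p\le\|f\|_{p,\tau}\,\|\mathcal N(\rho)\|_p$; ii) $\ \big\|\sigma^{-\frac1{2p'}}\mathcal N(\rho)\,\sigma^{-\frac1{2p'}}\big\|_p\le\big\|\sigma^{-\frac1{2p'}}\mathcal N_f(\rho)\,\sigma^{-\frac1{2p'}}\big\|_p\le\|f\|_{p,\tau}\,\big\|\sigma^{-\frac1{2p'}}\mathcal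 N(\rho)\,\sigma^{-\frac1{2p'}}\big\|_p$. -/

import Mathlib

open scoped ENNReal Matrix ComplexOrder

namespace TROChannel

/-! Finite dimensional Hilbert spaces are given by orthonormal bases: the Hilbert spaces
`H_A`, `H_B`, `H_E` are `ℂ^a`, `ℂ^b`, `ℂ^e` for finite index types `a`, `b`, `e`, the tensor product
`H_B ⊗ H_E` is `ℂ^(b × e)`, and operators are complex matrices. -/

section Traces

variable {n : Type*} [Fintype n] [DecidableEq n]

/-- The absolute value `|A| = (A* A)^(1/2)`. -/
noncomputable def absVal (A : Matrix n n ℂ) : Matrix n n ℂ :=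
  cfc Real.sqrt (Aᴴ * A)

/-- `tr (|A|^p)`, for a real exponent `p`. -/
noncomputable def traceAbsPow (p : ℝ) (A : Matrix n n ℂ) : ℝ :=
  (cfc (fun x : ℝ => x ^ p) (absVal A)).trace.re

/-- The operator norm of a matrix acting on the Hilbert space `ℂ^n`. -/
noncomputable def opNorm (A : Matrix n n ℂ) : ℝ :=
  ‖Matrix.toEuclideanCLM (n := n) (𝕜 := ℂ) A‖

/-- The Schatten `p`-norm `‖A‖_p = tr(|A|^p)^(1/p)`; for `p = ∞` it is the operator norm. -/
noncomputable def schattenNorm (p : ℝ≥0∞) (A : Matrix n n ℂ) : ℝ :=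
  if p = ∞ then opNorm A else traceAbsPow p.toReal A ^ (1 / p.toReal)

/-- The normalized trace `τ = tr / dim`. -/
noncomputable def normTrace (A : Matrix n n ℂ) : ℂ :=
  A.trace / (Fintype.card n : ℂ)

/-- The norm `‖A‖_{p,τ} = τ(|A|^p)^(1/p)` with respect to the normalized trace; for `p = ∞` it is
the operator norm. -/
noncomputable def normalizedLpNorm (p : ℝ≥0∞) (A : Matrix n n ℂ) : ℝ :=
  if p = ∞ then opNorm A
  else (traceAbsPow p.toReal A / (Fintype.card n : ℝ)) ^ (1 / p.toReal)

/-- The power `σ^(-s)` of a positive operator `σ`, where the inverse is taken on the support of `σ`: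
the eigenvalue `x ≠ 0` is sent to `x^(-s)` and the eigenvalue `0` to `0`. -/
noncomputable def negPow (σ : Matrix n n ℂ) (s : ℝ) : Matrix n n ℂ :=
  cfc (fun x : ℝ => if x = 0 then 0 else x ^ (-s)) σ

end Traces

section TRO

variable {b e : Type*} [Fintype b] [Fintype e]

/-- A ternary ring of operators in `B(H_E, H_B)`: a linear subspace `X` with `x y* z ∈ X` for all
`x, y, z ∈ X` (closedness is automatic in finite dimensions). -/
def IsTRO (X : Submodule ℂ (Matrix b e ℂ)) : Prop :=
  ∀ x ∈ X, ∀ y ∈ X, ∀ z ∈ X, x * yᴴ * z ∈ X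

/-- The left algebra `L(X) = span {x y* | x, y ∈ X} ⊆ B(H_B)`. -/
def leftAlgebra (X : Submodule ℂ (Matrix b e ℂ)) : Submodule ℂ (Matrix b b ℂ) :=
  Submodule.span ℂ {m | ∃ x ∈ X, ∃ y ∈ X, m = x * yᴴ}

/-- The right algebra `R(X) = span {x* y | x, y ∈ X} ⊆ B(H_E)`. -/
def rightAlgebra (X : Submodule ℂ (Matrix b e ℂ)) : Submodule ℂ (Matrix e e ℂ) :=
  Submodule.span ℂ {m | ∃ x ∈ X, ∃ y ∈ X, m = xᴴ * y}

end TRO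

section Independence

variable {e : Type*} [Fintype e] [DecidableEq e]

/-- `x` is independent of `M`: `τ(x y) = τ(x) τ(y)` for all `y ∈ M`. -/
def Independent (x : Matrix e e ℂ) (M : Submodule ℂ (Matrix e e ℂ)) : Prop :=
  ∀ y ∈ M, normTrace (x * y) = normTrace x * normTrace y

/-- `x` is strongly independent of `M`: all its powers are independent of `M`. -/
def StronglyIndependent (x : Matrix e e ℂ) (M : Submodule ℂ (Matrix e e ℂ)) : Prop :=
  ∀ n : ℕ, Independent (x ^ n) M

end Independence

section Channels

variable {a b e : Type*} [Fintype a] [Fintype b] [Fintype e]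
  [DecidableEq a] [DecidableEq b] [DecidableEq e]

/-- The partial trace `tr_E : B(H_B ⊗ H_E) → B(H_B)`. -/
def partialTraceE (T : Matrix (b × e) (b × e) ℂ) : Matrix b b ℂ :=
  Matrix.of fun i j => ∑ k, T (i, k) (j, k)

/-- `V : H_A → H_B ⊗ H_E` is a Stinespring isometry of `N : B(H_A) → B(H_B)`:
`V* V = 1` and `N(ρ) = tr_E (V ρ V*)`. (Such an `N` is automatically completely positive and
trace preserving, i.e. a quantum channel, and every quantum channel has such a `V`.) -/
structure IsStinespringDilation (N : Matrix a a ℂ →ₗ[ℂ] Matrix b b ℂ)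
    (V : Matrix (b × e) a ℂ) : Prop where
  isometry : Vᴴ * V = 1
  apply_eq : ∀ ρ, N ρ = partialTraceE (V * ρ * Vᴴ)

/-- The operator `h ∈ B(H_E, H_B)` that corresponds to `V|h⟩ ∈ H_B ⊗ H_E` under the identification
`∑ |h_i⟩ ⊗ |e_i⟩ ↦ ∑ |h_i⟩⟨e_i|`. -/
def toOperator (V : Matrix (b × e) a ℂ) : (a → ℂ) →ₗ[ℂ] Matrix b e ℂ where
  toFun h := Matrix.of fun i k => (V *ᵥ h) (i, k)
  map_add' h k := by ext i j; simp [Matrix.mulVec_add]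
  map_smul' c h := by ext i j; simp [Matrix.mulVec_smul]

/-- The Stinespring space `ran V`, viewed inside `B(H_E, H_B)`. -/
def stinespringSpace (V : Matrix (b × e) a ℂ) : Submodule ℂ (Matrix b e ℂ) :=
  LinearMap.range (toOperator V)

/-- `N` is a TRO channel, through the Stinespring isometry `V`. -/
structure IsTROChannel (N : Matrix a a ℂ →ₗ[ℂ] Matrix b b ℂ)
    (V : Matrix (b × e) a ℂ) : Prop extends IsStinespringDilation N V where
  isTRO : IsTRO (stinespringSpace V)

/-- `f` is a symbol: a positive operator on `H_E` with `τ(f) = 1` that is strongly independent of the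
right algebra of the Stinespring space. -/
structure IsSymbol (V : Matrix (b × e) a ℂ) (f : Matrix e e ℂ) : Prop where
  pos : f.PosSemidef
  normalized : normTrace f = 1
  stronglyIndependent : StronglyIndependent f (rightAlgebra (stinespringSpace V))

/-- The modified map `N_f : B(H_A) → B(H_B)`, the linear map with `N_f(|h⟩⟨k|) = h f k*`, where on
the right `h, k ∈ B(H_E, H_B)` are the operators of `V|h⟩, V|k⟩`. It is written here by expanding
its argument in the matrix units `|i⟩⟨j|`; see `modified_rankOne` for general `h` and `k`. -/
def modified (V : Matrix (b × e) a ℂ) (f : Matrix e e ℂ) :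
    Matrix a a ℂ →ₗ[ℂ] Matrix b b ℂ where
  toFun ρ := ∑ i, ∑ j,
    ρ i j • (toOperator V (Pi.single i 1) * f * (toOperator V (Pi.single j 1))ᴴ)
  map_add' ρ ρ' := by simp [add_smul, Finset.sum_add_distrib]
  map_smul' c ρ := by simp [mul_smul, Finset.smul_sum]

theorem toOperator_eq_sum (V : Matrix (b × e) a ℂ) (h : a → ℂ) :
    toOperator V h = ∑ i, h i • toOperator V (Pi.single i 1) := by
  ext i k
  simp [toOperator, Matrix.mulVec, dotProduct, Matrix.sum_apply, Pi.single_apply, mul_comm]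

/-- The defining property `N_f(|h⟩⟨k|) = h f k*`. -/
theorem modified_rankOne (V : Matrix (b × e) a ℂ) (f : Matrix e e ℂ) (h k : a → ℂ) :
    modified V f (Matrix.vecMulVec h (star k)) = toOperator V h * f * (toOperator V k)ᴴ := by
  rw [toOperator_eq_sum V h, toOperator_eq_sum V k]
  simp only [modified, LinearMap.coe_mk, AddHom.coe_mk, Matrix.conjTranspose_sum,
    Matrix.conjTranspose_smul, Matrix.sum_mul, Matrix.mul_sum, Matrix.smul_mul, Matrix.mul_smul,
    Matrix.vecMulVec_apply, Pi.star_apply, Finset.smul_sum, smul_smul]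
  rw [Finset.sum_comm]
  simp only [mul_comm]

/-- For `f = 1` the modified map is the channel itself. -/
theorem modified_one {N : Matrix a a ℂ →ₗ[ℂ] Matrix b b ℂ} {V : Matrix (b × e) a ℂ}
    (hV : IsStinespringDilation N V) : modified V (1 : Matrix e e ℂ) = N := by
  refine LinearMap.ext fun ρ => ?_
  rw [hV.apply_eq]
  ext i j
  simp only [modified, LinearMap.coe_mk, AddHom.coe_mk, partialTraceE, toOperator, Matrix.sum_apply,
    Matrix.mul_apply, Matrix.smul_apply, Matrix.mul_one, Matrix.conjTranspose_apply,
    Matrix.mulVec_single_one, Matrix.of_apply, Matrix.col_apply, smul_eq_mul, Finset.mul_sum,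
    Finset.sum_mul]
  rw [Finset.sum_comm]
  conv_rhs =>
    rw [Finset.sum_comm]
    enter [2, y]
    rw [Finset.sum_comm]
  refine Finset.sum_congr rfl fun y _ => ?_
  refine Finset.sum_congr rfl fun k _ => Finset.sum_congr rfl fun x _ => ?_
  ring

end Channels

end TROChannel

/-! Write `ρ = ∑ |v_k⟩⟨v_k|` and let `x_k ∈ X` be the operator of `V|v_k⟩`. The two outputs become
`B = ∑ x_k x_k*` and `C = ∑ x_k f x_k*`, and everything is proved for such sums over a TRO. The
weighted statement is the same statement for the family `s x_k`, where `s` is the negative power of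
`σ`: polynomials in `σ ∈ L(X)` map `X` into itself, so `s x_k ∈ X`.

Independence gives `tr (x φ(f) y*) = τ(φ(f)) tr (x y*)` for `x, y ∈ X` and every function `φ`
(`trace_mul_specFun_mul`). Since `g(B) x_k ∈ X`, the case `φ = id` yields `tr (C g(B)) = tr (B
g(B))`.

Lower bound: by convexity of `t ^ p`, `tr C^p ≥ tr B^p + p tr ((C - B) B^(p-1))`, and the last term
vanishes. For `p = ∞` the operators are tested against spectral projections of `B`.

Upper bound: with the row `T = (x_1, …, x_m)` and `F = f ⊗ 1` one has `B = T T*` and `C = T F T*`.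
An Araki-Lieb-Thirring inequality (`trace_rpow_le_of_one_le`, by the three lines theorem) gives `tr
C^p ≤ tr (w T F^p T* w)` with `w = B^((p-1)/2)`. As `w x_k ∈ X`, independence evaluates the right
side to `τ(f^p) tr (w B w) = τ(f^p) tr B^p`. For `p = ∞` it is enough that `f ≤ ‖f‖ 1`. -/

namespace TROChannel

open scoped Matrix.Norms.L2Operator
open Polynomial (aeval)

/-! ### Functional calculus of Hermitian matrices through diagonalization. -/

section SpectralFunctions

variable {n : Type*} [Fintype n] [DecidableEq n] {A : Matrix n n ℂ}

/-- The complex valued functional calculus of a Hermitian matrix. -/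
noncomputable def specFun (hA : A.IsHermitian) (g : ℝ → ℂ) : Matrix n n ℂ :=
  (hA.eigenvectorUnitary : Matrix n n ℂ) * Matrix.diagonal (fun i => g (hA.eigenvalues i)) *
    (hA.eigenvectorUnitary : Matrix n n ℂ)ᴴ

theorem eigenvectorUnitary_star_mul_self (hA : A.IsHermitian) :
    (hA.eigenvectorUnitary : Matrix n n ℂ)ᴴ * (hA.eigenvectorUnitary : Matrix n n ℂ) = 1 :=
  Unitary.coe_star_mul_self hA.eigenvectorUnitary

theorem eigenvectorUnitary_mul_star_self (hA : A.IsHermitian) :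
    (hA.eigenvectorUnitary : Matrix n n ℂ) * (hA.eigenvectorUnitary : Matrix n n ℂ)ᴴ = 1 :=
  Unitary.coe_mul_star_self hA.eigenvectorUnitary

theorem specFun_congr (hA : A.IsHermitian) {g g' : ℝ → ℂ}
    (h : ∀ i, g (hA.eigenvalues i) = g' (hA.eigenvalues i)) : specFun hA g = specFun hA g' := by
  simp only [specFun, h]

theorem specFun_mul (hA : A.IsHermitian) (g g' : ℝ → ℂ) :
    specFun hA g * specFun hA g' = specFun hA fun x => g x * g' x := by
  simp only [specFun]
  rw [← Matrix.diagonal_mul_diagonal]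
  set U := (hA.eigenvectorUnitary : Matrix n n ℂ)
  have hU : Uᴴ * U = 1 := eigenvectorUnitary_star_mul_self hA
  calc _ = U * Matrix.diagonal (fun i => g (hA.eigenvalues i)) * (Uᴴ * U) *
        Matrix.diagonal (fun i => g' (hA.eigenvalues i)) * Uᴴ := by simp only [mul_assoc]
    _ = _ := by rw [hU]; simp only [mul_assoc, one_mul]

theorem specFun_one (hA : A.IsHermitian) : specFun hA (fun _ => 1) = 1 := by
  simp [specFun, Matrix.diagonal_one, eigenvectorUnitary_mul_star_self]

theorem specFun_id (hA : A.IsHermitian) : specFun hA (fun x => (x : ℂ)) = A := by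
  conv_rhs => rw [hA.spectral_theorem]
  rfl

theorem specFun_conjTranspose (hA : A.IsHermitian) (g : ℝ → ℂ) :
    (specFun hA g)ᴴ = specFun hA fun x => star (g x) := by
  simp only [specFun, Matrix.conjTranspose_mul, Matrix.diagonal_conjTranspose,
    Matrix.conjTranspose_conjTranspose, mul_assoc]
  rfl

theorem cfc_eq_specFun (hA : A.IsHermitian) (g : ℝ → ℝ) :
    cfc g A = specFun hA fun x => (g x : ℂ) := by
  rw [hA.cfc_eq g]
  rfl

theorem trace_specFun (hA : A.IsHermitian) (g : ℝ → ℂ) :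
    (specFun hA g).trace = ∑ i, g (hA.eigenvalues i) := by
  rw [specFun, Matrix.trace_mul_cycle, eigenvectorUnitary_star_mul_self, one_mul,
    Matrix.trace_diagonal]

theorem norm_le_one_of_star_mul_self {U : Matrix n n ℂ} (hU : Uᴴ * U = 1) : ‖U‖ ≤ 1 := by
  have h := Matrix.l2_opNorm_conjTranspose_mul_self U
  rw [hU] at h
  have h1 : ‖(1 : Matrix n n ℂ)‖ ≤ 1 := by
    rw [← Matrix.diagonal_one, Matrix.l2_opNorm_diagonal]
    exact (pi_norm_le_iff_of_nonneg zero_le_one).2 fun i => by simp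
  nlinarith [norm_nonneg U]

theorem norm_specFun_le (hA : A.IsHermitian) {g : ℝ → ℂ} {C : ℝ} (hC : 0 ≤ C)
    (h : ∀ i, ‖g (hA.eigenvalues i)‖ ≤ C) : ‖specFun hA g‖ ≤ C := by
  have h1 := norm_le_one_of_star_mul_self (eigenvectorUnitary_star_mul_self hA)
  have h2 := h1
  rw [← Matrix.l2_opNorm_conjTranspose] at h2
  have h3 : ‖Matrix.diagonal fun i => g (hA.eigenvalues i)‖ ≤ C := by
    rw [Matrix.l2_opNorm_diagonal]
    exact (pi_norm_le_iff_of_nonneg hC).2 h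
  refine (Matrix.l2_opNorm_mul _ _).trans ?_
  refine (mul_le_mul ((Matrix.l2_opNorm_mul _ _).trans
    (mul_le_mul h1 h3 (norm_nonneg _) zero_le_one)) h2 (norm_nonneg _) (by positivity)).trans ?_
  simp

theorem specFun_pow (hA : A.IsHermitian) (k : ℕ) :
    specFun hA (fun x => (x : ℂ) ^ k) = A ^ k := by
  induction k with
  | zero => simpa using specFun_one hA
  | succ k ih =>
    have h := specFun_mul hA (fun x => (x : ℂ) ^ k) fun x => (x : ℂ)
    rw [specFun_id, ih] at h
    simp only [pow_succ, h]

theorem specFun_add (hA : A.IsHermitian) (g g' : ℝ → ℂ) :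
    specFun hA (fun x => g x + g' x) = specFun hA g + specFun hA g' := by
  simp only [specFun]
  rw [← Matrix.diagonal_add, mul_add, add_mul]

theorem specFun_const_mul (hA : A.IsHermitian) (c : ℂ) (g : ℝ → ℂ) :
    specFun hA (fun x => c * g x) = c • specFun hA g := by
  have : (fun i => c * g (hA.eigenvalues i)) = c • fun i => g (hA.eigenvalues i) := rfl
  simp only [specFun]
  rw [this, Matrix.diagonal_smul, Matrix.mul_smul, Matrix.smul_mul]

theorem specFun_polynomial (hA : A.IsHermitian) (q : Polynomial ℂ) :
    specFun hA (fun x => q.eval (x : ℂ)) = aeval A q := by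
  induction q using Polynomial.induction_on' with
  | add p q hp hq => simp only [Polynomial.eval_add, specFun_add, hp, hq, map_add]
  | monomial k c =>
    simp only [Polynomial.eval_monomial, specFun_const_mul, specFun_pow, Polynomial.aeval_monomial]
    rw [Algebra.smul_def]

/-- The weights are the squared overlaps of the two eigenbases. As they are nonnegative, a scalar
inequality between the eigenvalues passes to traces. -/
theorem trace_specFun_mul_specFun {B : Matrix n n ℂ} (hA : A.IsHermitian) (hB : B.IsHermitian)
    (g g' : ℝ → ℂ) :
    (specFun hA g * specFun hB g').trace =
      ∑ i, ∑ j, g (hA.eigenvalues i) * g' (hB.eigenvalues j) *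
        (Complex.normSq (((hA.eigenvectorUnitary : Matrix n n ℂ)ᴴ *
          (hB.eigenvectorUnitary : Matrix n n ℂ)) i j) : ℂ) := by
  set U := (hA.eigenvectorUnitary : Matrix n n ℂ) with hU
  set W := (hB.eigenvectorUnitary : Matrix n n ℂ) with hW
  have : specFun hA g * specFun hB g' = U * (Matrix.diagonal (fun i => g (hA.eigenvalues i)) *
      ((Uᴴ * W) * Matrix.diagonal (fun i => g' (hB.eigenvalues i)) * Wᴴ)) := by
    simp only [specFun, ← hU, ← hW, mul_assoc]
  rw [this, Matrix.trace_mul_comm]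
  have h2 : Matrix.diagonal (fun i => g (hA.eigenvalues i)) *
      ((Uᴴ * W) * Matrix.diagonal (fun i => g' (hB.eigenvalues i)) * Wᴴ) * U =
      Matrix.diagonal (fun i => g (hA.eigenvalues i)) *
      ((Uᴴ * W) * Matrix.diagonal (fun i => g' (hB.eigenvalues i)) * (Uᴴ * W)ᴴ) := by
    simp only [mul_assoc, Matrix.conjTranspose_mul, Matrix.conjTranspose_conjTranspose]
  rw [h2, Matrix.trace]
  refine Finset.sum_congr rfl fun i _ => ?_
  rw [Matrix.diag_apply, Matrix.diagonal_mul, Matrix.mul_apply, Finset.mul_sum]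
  refine Finset.sum_congr rfl fun j _ => ?_
  rw [Matrix.mul_diagonal, Matrix.conjTranspose_apply, Complex.normSq_eq_conj_mul_self]
  simp only [RCLike.star_def]
  ring

end SpectralFunctions

/-! ### Complex powers on the support. -/

section ComplexPowers

/-- The complex power `x ^ z`, with value `0` at `x = 0` for every exponent. -/
noncomputable def suppPow (z : ℂ) (x : ℝ) : ℂ :=
  if x = 0 then 0 else Complex.exp (z * Real.log x)

theorem suppPow_mul (z w : ℂ) (x : ℝ) : suppPow z x * suppPow w x = suppPow (z + w) x := by
  unfold suppPow
  split_ifs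
  · simp
  · rw [← Complex.exp_add, add_mul]

theorem star_suppPow (z : ℂ) (x : ℝ) : star (suppPow z x) = suppPow (star z) x := by
  unfold suppPow
  split_ifs
  · simp
  · simp only [RCLike.star_def, ← Complex.exp_conj, map_mul, Complex.conj_ofReal]

theorem suppPow_ofReal {x : ℝ} (hx : 0 ≤ x) {r : ℝ} (hr : r ≠ 0) :
    suppPow r x = ((x ^ r : ℝ) : ℂ) := by
  unfold suppPow
  split_ifs with h
  · simp [h, Real.zero_rpow hr]
  · rw [Real.rpow_def_of_pos (lt_of_le_of_ne hx (Ne.symm h)), ← Complex.ofReal_mul,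
      ← Complex.ofReal_exp, mul_comm]

theorem suppPow_one {x : ℝ} (hx : 0 ≤ x) : suppPow 1 x = x := by
  have := suppPow_ofReal hx one_ne_zero
  simpa using this

/-- An imaginary power is a phase on the support, so it gives a contraction; this controls the
boundary lines of the strip. -/
theorem norm_suppPow_le_one {z : ℂ} (hz : z.re = 0) (x : ℝ) : ‖suppPow z x‖ ≤ 1 := by
  unfold suppPow
  split_ifs
  · simp
  · rw [Complex.norm_exp]
    simp [Complex.mul_re, hz]

variable {n : Type*} [Fintype n] [DecidableEq n] {A : Matrix n n ℂ}

theorem specFun_suppPow_mul (hA : A.IsHermitian) (z w : ℂ) :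
    specFun hA (suppPow z) * specFun hA (suppPow w) = specFun hA (suppPow (z + w)) := by
  rw [specFun_mul]
  exact specFun_congr hA fun i => suppPow_mul _ _ _

theorem specFun_suppPow_conjTranspose (hA : A.IsHermitian) (z : ℂ) :
    (specFun hA (suppPow z))ᴴ = specFun hA (suppPow (star z)) := by
  rw [specFun_conjTranspose]
  exact specFun_congr hA fun i => star_suppPow _ _

theorem specFun_suppPow_one (hA : A.PosSemidef) : specFun hA.1 (suppPow 1) = A := by
  conv_rhs => rw [← specFun_id hA.1]
  exact specFun_congr hA.1 fun i => suppPow_one (hA.eigenvalues_nonneg i)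

theorem norm_specFun_suppPow_le_one (hA : A.IsHermitian) {z : ℂ} (hz : z.re = 0) :
    ‖specFun hA (suppPow z)‖ ≤ 1 :=
  norm_specFun_le hA zero_le_one fun _ => norm_suppPow_le_one hz _

/-- The support projection of `T T*` fixes `T`. -/
theorem specFun_suppPow_zero_mul {m : Type*} [Fintype m] {T : Matrix n m ℂ}
    (hB : (T * Tᴴ).PosSemidef) : specFun hB.1 (suppPow 0) * T = T := by
  set P := specFun hB.1 (suppPow 0) with hP
  have hPs : Pᴴ = P := by rw [hP, specFun_suppPow_conjTranspose]; simp
  have hPB : P * (T * Tᴴ) = T * Tᴴ := by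
    have h := specFun_suppPow_mul hB.1 0 1
    rwa [zero_add, specFun_suppPow_one hB] at h
  -- Since `P` fixes `T T*`, the four terms of the expansion cancel, and `M M* = 0` forces `M = 0`.
  have h0 : (P * T - T) * (P * T - T)ᴴ = 0 := by
    have : (P * T - T) * (P * T - T)ᴴ =
        P * (T * Tᴴ) * P - P * (T * Tᴴ) - (T * Tᴴ) * P + T * Tᴴ := by
      simp only [Matrix.conjTranspose_sub, Matrix.conjTranspose_mul, hPs, Matrix.sub_mul,
        Matrix.mul_sub, Matrix.mul_assoc]
      abel
    rw [this, hPB]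
    abel
  exact sub_eq_zero.1 (Matrix.self_mul_conjTranspose_eq_zero.1 h0)

end ComplexPowers

/-! ### Hilbert-Schmidt norm: Cauchy-Schwarz and multiplication by contractions. -/

section HilbertSchmidt

variable {l m n : Type*} [Fintype l] [Fintype m] [Fintype n]

/-- The square of the Hilbert-Schmidt norm. -/
noncomputable def hsNormSq (A : Matrix m n ℂ) : ℝ := ∑ i, ∑ j, ‖A i j‖ ^ 2

theorem hsNormSq_nonneg (A : Matrix m n ℂ) : 0 ≤ hsNormSq A :=
  Finset.sum_nonneg fun _ _ => Finset.sum_nonneg fun _ _ => sq_nonneg _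

theorem hsNormSq_conjTranspose (A : Matrix m n ℂ) : hsNormSq Aᴴ = hsNormSq A := by
  unfold hsNormSq
  rw [Finset.sum_comm]
  simp [Matrix.conjTranspose_apply]

theorem ofReal_hsNormSq (A : Matrix m n ℂ) : (hsNormSq A : ℂ) = (A * Aᴴ).trace := by
  simp only [hsNormSq, Matrix.trace, Matrix.diag_apply, Matrix.mul_apply,
    Matrix.conjTranspose_apply, Complex.ofReal_sum]
  refine Finset.sum_congr rfl fun i _ => Finset.sum_congr rfl fun j _ => ?_
  rw [RCLike.star_def, Complex.mul_conj, Complex.normSq_eq_norm_sq]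

/-- Cauchy-Schwarz over all pairs of indices. -/
theorem norm_trace_mul_le (A : Matrix m n ℂ) (B : Matrix n m ℂ) :
    ‖(A * B).trace‖ ≤ √(hsNormSq A) * √(hsNormSq B) := by
  rw [← Real.sqrt_mul (hsNormSq_nonneg A), ← hsNormSq_conjTranspose B]
  refine Real.le_sqrt_of_sq_le ?_
  have h1 : ‖(A * B).trace‖ ≤ ∑ x : m × n, ‖A x.1 x.2‖ * ‖Bᴴ x.1 x.2‖ := by
    rw [Matrix.trace, Fintype.sum_prod_type]
    refine (norm_sum_le _ _).trans (Finset.sum_le_sum fun i _ => ?_)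
    rw [Matrix.diag_apply, Matrix.mul_apply]
    refine (norm_sum_le _ _).trans (Finset.sum_le_sum fun j _ => ?_)
    rw [norm_mul, Matrix.conjTranspose_apply, norm_star]
  have h2 := Finset.sum_mul_sq_le_sq_mul_sq (Finset.univ : Finset (m × n))
    (fun x => ‖A x.1 x.2‖) fun x => ‖Bᴴ x.1 x.2‖
  simp only [hsNormSq, ← Fintype.sum_prod_type' (f := fun i j => ‖A i j‖ ^ 2),
    ← Fintype.sum_prod_type' (f := fun i j => ‖Bᴴ i j‖ ^ 2)]
  exact (pow_le_pow_left₀ (norm_nonneg _) h1 2).trans h2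

/-- A contraction shrinks every column of `A`, and the squared norm is the sum over the columns. -/
theorem hsNormSq_mul_le_left [DecidableEq m] (K : Matrix l m ℂ) (A : Matrix m n ℂ)
    (hK : ‖K‖ ≤ 1) : hsNormSq (K * A) ≤ hsNormSq A := by
  unfold hsNormSq
  rw [Finset.sum_comm]
  conv_rhs => rw [Finset.sum_comm]
  refine Finset.sum_le_sum fun j _ => ?_
  have h := Matrix.l2_opNorm_mulVec K (WithLp.toLp 2 fun i => A i j)
  have h2 := h.trans (mul_le_of_le_one_left (norm_nonneg _) hK)
  have h3 := pow_le_pow_left₀ (norm_nonneg _) h2 2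
  rw [EuclideanSpace.norm_sq_eq, EuclideanSpace.norm_sq_eq] at h3
  exact h3

theorem hsNormSq_mul_le_right [DecidableEq l] [DecidableEq m] [DecidableEq n] (K : Matrix m l ℂ)
    (A : Matrix n m ℂ) (hK : ‖K‖ ≤ 1) : hsNormSq (A * K) ≤ hsNormSq A := by
  rw [← hsNormSq_conjTranspose, Matrix.conjTranspose_mul, ← hsNormSq_conjTranspose A]
  exact hsNormSq_mul_le_left _ _ (by rwa [Matrix.l2_opNorm_conjTranspose])

theorem norm_mul_le_one {K : Matrix l m ℂ} {K' : Matrix m n ℂ} [DecidableEq m] [DecidableEq n]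
    (hK : ‖K‖ ≤ 1) (hK' : ‖K'‖ ≤ 1) : ‖K * K'‖ ≤ 1 :=
  (Matrix.l2_opNorm_mul _ _).trans (mul_le_one₀ hK (norm_nonneg _) hK')

end HilbertSchmidt

/-! ### Entire functions on the strip and the three lines theorem. -/

section ThreeLines

/-- Entire functions that are bounded on the strip `0 ≤ re z ≤ 1`. -/
def EntireBddOnStrip (g : ℂ → ℂ) : Prop :=
  Differentiable ℂ g ∧ ∃ C, ∀ z : ℂ, 0 ≤ z.re → z.re ≤ 1 → ‖g z‖ ≤ C

theorem EntireBddOnStrip.const (c : ℂ) : EntireBddOnStrip fun _ => c :=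
  ⟨differentiable_const c, ‖c‖, fun _ _ _ => le_rfl⟩

theorem EntireBddOnStrip.mul {g g' : ℂ → ℂ} (h : EntireBddOnStrip g) (h' : EntireBddOnStrip g') :
    EntireBddOnStrip fun z => g z * g' z := by
  obtain ⟨hd, C, hC⟩ := h
  obtain ⟨hd', C', hC'⟩ := h'
  refine ⟨hd.mul hd', C * C', fun z h0 h1 => ?_⟩
  rw [norm_mul]
  exact mul_le_mul (hC z h0 h1) (hC' z h0 h1) (norm_nonneg _)
    ((norm_nonneg _).trans (hC z h0 h1))

theorem EntireBddOnStrip.sum {ι : Type*} [Fintype ι] {g : ι → ℂ → ℂ}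
    (h : ∀ i, EntireBddOnStrip (g i)) : EntireBddOnStrip fun z => ∑ i, g i z := by
  choose hd C hC using h
  refine ⟨Differentiable.fun_sum fun i _ => hd i, ∑ i, C i, fun z h0 h1 => ?_⟩
  exact (norm_sum_le _ _).trans (Finset.sum_le_sum fun i _ => hC i z h0 h1)

/-- With `c`, `d` real, the imaginary part of `z` changes only the phase, so the modulus depends on
`re z ∈ [0, 1]` alone. -/
theorem EntireBddOnStrip.suppPow (c d : ℝ) (x : ℝ) :
    EntireBddOnStrip fun z => suppPow (c + d * z) x := by
  unfold TROChannel.suppPow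
  split_ifs
  · exact .const 0
  refine ⟨by fun_prop, Real.exp ((|c| + |d|) * |Real.log x|), fun z h0 h1 => ?_⟩
  rw [Complex.norm_exp, Real.exp_le_exp]
  have hre : (((c : ℂ) + d * z) * (Real.log x : ℂ)).re = (c + d * z.re) * Real.log x := by
    simp [Complex.mul_re]
  rw [hre]
  refine (le_abs_self _).trans ?_
  rw [abs_mul]
  refine mul_le_mul_of_nonneg_right ((abs_add_le _ _).trans ?_) (abs_nonneg _)
  rw [abs_mul, abs_of_nonneg h0]
  nlinarith [abs_nonneg d]

/-- Matrix valued functions whose entries are bounded on the strip and entire. -/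
def MatrixEntireBdd {m n : Type*} (G : ℂ → Matrix m n ℂ) : Prop :=
  ∀ i j, EntireBddOnStrip fun z => G z i j

theorem MatrixEntireBdd.const {m n : Type*} (M : Matrix m n ℂ) : MatrixEntireBdd fun _ => M :=
  fun i j => .const (M i j)

theorem MatrixEntireBdd.mul {l m n : Type*} [Fintype m] {G : ℂ → Matrix l m ℂ}
    {G' : ℂ → Matrix m n ℂ} (h : MatrixEntireBdd G) (h' : MatrixEntireBdd G') :
    MatrixEntireBdd fun z => G z * G' z := by
  intro i j
  simp only [Matrix.mul_apply]
  exact .sum fun k => (h i k).mul (h' k j)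

theorem MatrixEntireBdd.trace {n : Type*} [Fintype n] {G : ℂ → Matrix n n ℂ}
    (h : MatrixEntireBdd G) : EntireBddOnStrip fun z => (G z).trace := by
  simp only [Matrix.trace, Matrix.diag_apply]
  exact .sum fun i => h i i

theorem MatrixEntireBdd.specFun_suppPow {n : Type*} [Fintype n] [DecidableEq n]
    {A : Matrix n n ℂ} (hA : A.IsHermitian) (c d : ℝ) :
    MatrixEntireBdd fun z => specFun hA (suppPow (c + d * z)) := by
  refine ((MatrixEntireBdd.const _).mul fun i j => ?_).mul (.const _)
  simp only [Matrix.diagonal_apply]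
  split_ifs
  · exact .suppPow _ _ _
  · exact .const 0

open Complex.HadamardThreeLines in
theorem EntireBddOnStrip.norm_le_interp {g : ℂ → ℂ} (hg : EntireBddOnStrip g) {a b t : ℝ}
    (ht0 : 0 ≤ t) (ht1 : t ≤ 1) (ha : ∀ z : ℂ, z.re = 0 → ‖g z‖ ≤ a)
    (hb : ∀ z : ℂ, z.re = 1 → ‖g z‖ ≤ b) : ‖g t‖ ≤ a ^ (1 - t) * b ^ t := by
  obtain ⟨hd, C, hC⟩ := hg
  have h := norm_le_interp_of_mem_verticalClosedStrip' (f := g) (z := t) (a := a) (b := b)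
    zero_lt_one (by simpa [verticalClosedStrip] using ⟨ht0, ht1⟩) hd.diffContOnCl
    ⟨C, by
      rintro _ ⟨z, hz, rfl⟩
      exact hC z hz.1 hz.2⟩ (fun z hz => ha z hz) fun z hz => hb z hz
  simpa using h

end ThreeLines

/-! ### An Araki-Lieb-Thirring inequality by complex interpolation. -/

section ArakiLiebThirring

variable {m n : Type*} [Fintype m] [Fintype n] [DecidableEq m] [DecidableEq n]

theorem hsNormSq_specFun_suppPow {A : Matrix n n ℂ} (hA : A.IsHermitian) (r : ℝ) :
    (hsNormSq (specFun hA (suppPow (r / 2 : ℝ))) : ℂ) = (specFun hA (suppPow r)).trace := by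
  rw [ofReal_hsNormSq, specFun_suppPow_conjTranspose, specFun_suppPow_mul]
  congr 3
  simp only [RCLike.star_def, Complex.conj_ofReal]
  push_cast
  ring

/-- A form of the Araki-Lieb-Thirring inequality
`tr (T F T*)^p ≤ tr (w T F^p T* w)` with `w = (T T*)^((p-1)/2)`. -/
theorem trace_rpow_le_of_one_le {T : Matrix m n ℂ} {F : Matrix n n ℂ} (hF : F.PosSemidef)
    (hB : (T * Tᴴ).PosSemidef) (hC : (T * F * Tᴴ).PosSemidef) {p : ℝ} (hp : 1 ≤ p) :
    (specFun hC.1 (suppPow p)).trace.re ≤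
      hsNormSq (specFun hB.1 (suppPow ((p - 1) / 2 : ℝ)) * T *
        specFun hF.1 (suppPow (p / 2 : ℝ))) := by
  have hp0 : 0 < p := by linarith
  set U := specFun hB.1 (suppPow (-1 / 2 : ℝ)) * T with hU
  have hUU : specFun hB.1 (suppPow (1 / 2 : ℝ)) * U = T := by
    rw [hU, ← Matrix.mul_assoc, specFun_suppPow_mul]
    convert specFun_suppPow_zero_mul hB using 4
    push_cast
    ring
  have hUn : ‖U‖ ≤ 1 := by
    have h1 : U * Uᴴ = specFun hB.1 (suppPow 0) := by
      have : U * Uᴴ = specFun hB.1 (suppPow (-1 / 2 : ℝ)) * specFun hB.1 (suppPow 1) *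
          specFun hB.1 (suppPow (-1 / 2 : ℝ)) := by
        rw [specFun_suppPow_one hB, hU, Matrix.conjTranspose_mul, specFun_suppPow_conjTranspose]
        simp only [Matrix.mul_assoc, RCLike.star_def, Complex.conj_ofReal]
      rw [this, specFun_suppPow_mul, specFun_suppPow_mul]
      congr 2
      push_cast
      ring
    have h2 := Matrix.l2_opNorm_conjTranspose_mul_self Uᴴ
    rw [Matrix.conjTranspose_conjTranspose, h1, Matrix.l2_opNorm_conjTranspose] at h2
    have h3 := norm_specFun_suppPow_le_one hB.1 (z := 0) (by simp)
    nlinarith [norm_nonneg U]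
  have hUn' : ‖Uᴴ‖ ≤ 1 := by rwa [Matrix.l2_opNorm_conjTranspose]
  set S : ℝ := (specFun hC.1 (suppPow p)).trace.re with hS
  have hSC : (S : ℂ) = (specFun hC.1 (suppPow p)).trace := by
    rw [← hsNormSq_specFun_suppPow] at hS ⊢
    rw [hS, Complex.ofReal_re]
  have hS2 : S = hsNormSq (specFun hC.1 (suppPow (p / 2 : ℝ))) := by
    have := hsNormSq_specFun_suppPow hC.1 p
    rw [← hSC] at this
    exact_mod_cast this.symm
  have hS0 : 0 ≤ S := hS2 ▸ hsNormSq_nonneg _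
  set R := specFun hB.1 (suppPow (p / 2 : ℝ)) * U * specFun hF.1 (suppPow (p / 2 : ℝ)) with hR
  have hRe : R = specFun hB.1 (suppPow ((p - 1) / 2 : ℝ)) * T *
      specFun hF.1 (suppPow (p / 2 : ℝ)) := by
    rw [hR, hU, ← Matrix.mul_assoc (specFun hB.1 _), specFun_suppPow_mul]
    congr 5
    push_cast
    ring
  rw [← hRe]
  set b := fun z : ℂ => specFun hB.1 (suppPow ((0 : ℝ) + (p / 2 : ℝ) * z)) with hb
  -- `g(z) = tr (C^(p(1-z)) B^(pz/2) U F^(pz) U* B^(pz/2))` with `C = T F T*`. It is bounded by `tr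
  -- C^p` on `re z = 0` and by the desired right side on `re z = 1`, and it equals `tr C^p` at `z =
  -- 1/p`.
  set g : ℂ → ℂ := fun z =>
    (specFun hC.1 (suppPow (p + (-p : ℝ) * z)) *
      (b z * U * specFun hF.1 (suppPow ((0 : ℝ) + p * z)) * Uᴴ * b z)).trace with hg
  have hgE : EntireBddOnStrip g :=
    ((MatrixEntireBdd.specFun_suppPow hC.1 p (-p)).mul
      (((((MatrixEntireBdd.specFun_suppPow hB.1 0 (p / 2)).mul (.const U)).mul
        (MatrixEntireBdd.specFun_suppPow hF.1 0 p)).mul (.const Uᴴ)).mul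
        (MatrixEntireBdd.specFun_suppPow hB.1 0 (p / 2)))).trace
  have hg0 : ∀ z : ℂ, z.re = 0 → ‖g z‖ ≤ S := by
    intro z hz
    have hbn : ‖b z‖ ≤ 1 := norm_specFun_suppPow_le_one _ (by simp [hz])
    have hK : ‖b z * U * specFun hF.1 (suppPow ((0 : ℝ) + p * z)) * Uᴴ * b z‖ ≤ 1 :=
      norm_mul_le_one (norm_mul_le_one (norm_mul_le_one (norm_mul_le_one hbn hUn)
        (norm_specFun_suppPow_le_one _ (by simp [hz]))) hUn') hbn
    -- One factor `C^(p/2)` goes to each side of Cauchy-Schwarz; all the remaining factors are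
    -- contractions.
    have hsplit : specFun hC.1 (suppPow (p + (-p : ℝ) * z)) =
        specFun hC.1 (suppPow (p / 2 : ℝ)) * specFun hC.1 (suppPow ((-p : ℝ) * z)) *
          specFun hC.1 (suppPow (p / 2 : ℝ)) := by
      rw [specFun_suppPow_mul, specFun_suppPow_mul]
      congr 2
      push_cast
      ring
    simp only [hg]
    rw [hsplit, Matrix.mul_assoc]
    refine (norm_trace_mul_le _ _).trans ?_
    have h1 := Real.sqrt_le_sqrt (hsNormSq_mul_le_right (specFun hC.1 (suppPow ((-p : ℝ) * z)))
      (specFun hC.1 (suppPow (p / 2 : ℝ))) (norm_specFun_suppPow_le_one _ (by simp [hz])))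
    have h2 := Real.sqrt_le_sqrt (hsNormSq_mul_le_right _
      (specFun hC.1 (suppPow (p / 2 : ℝ))) hK)
    refine (mul_le_mul h1 h2 (Real.sqrt_nonneg _) (Real.sqrt_nonneg _)).trans ?_
    rw [Real.mul_self_sqrt (hsNormSq_nonneg _), hS2]
  have hg1 : ∀ z : ℂ, z.re = 1 → ‖g z‖ ≤ hsNormSq R := by
    intro z hz
    have hK1 : ‖specFun hC.1 (suppPow (p + (-p : ℝ) * z))‖ ≤ 1 :=
      norm_specFun_suppPow_le_one _ (by simp [hz])
    have hK2 : ‖specFun hB.1 (suppPow ((p / 2 : ℝ) * (z - 1)))‖ ≤ 1 :=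
      norm_specFun_suppPow_le_one _ (by simp [hz])
    have hK3 : ‖specFun hF.1 (suppPow (p * (z - 1)))‖ ≤ 1 :=
      norm_specFun_suppPow_le_one _ (by simp [hz])
    have hb1 : b z = specFun hB.1 (suppPow ((p / 2 : ℝ) * (z - 1))) *
        specFun hB.1 (suppPow (p / 2 : ℝ)) := by
      rw [specFun_suppPow_mul]
      simp only [hb]
      congr 2
      push_cast
      ring
    have hb2 : b z = specFun hB.1 (suppPow (p / 2 : ℝ)) *
        specFun hB.1 (suppPow ((p / 2 : ℝ) * (z - 1))) := by
      rw [specFun_suppPow_mul]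
      simp only [hb]
      congr 2
      push_cast
      ring
    have hf : specFun hF.1 (suppPow ((0 : ℝ) + p * z)) = specFun hF.1 (suppPow (p / 2 : ℝ)) *
        (specFun hF.1 (suppPow (p * (z - 1))) * specFun hF.1 (suppPow (p / 2 : ℝ))) := by
      rw [specFun_suppPow_mul, specFun_suppPow_mul]
      congr 2
      push_cast
      ring
    have hRs : Rᴴ = specFun hF.1 (suppPow (p / 2 : ℝ)) * Uᴴ *
        specFun hB.1 (suppPow (p / 2 : ℝ)) := by
      rw [hR]
      simp only [Matrix.conjTranspose_mul, specFun_suppPow_conjTranspose, RCLike.star_def,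
        Complex.conj_ofReal, Matrix.mul_assoc]
    -- On `re z = 1` the real parts of the exponents assemble into `R` and `R*`; only imaginary
    -- powers are left around them.
    have hfac : specFun hC.1 (suppPow (p + (-p : ℝ) * z)) *
        (b z * U * specFun hF.1 (suppPow ((0 : ℝ) + p * z)) * Uᴴ * b z) =
        ((specFun hC.1 (suppPow (p + (-p : ℝ) * z)) *
          specFun hB.1 (suppPow ((p / 2 : ℝ) * (z - 1)))) * R *
          specFun hF.1 (suppPow (p * (z - 1)))) *
          (Rᴴ * specFun hB.1 (suppPow ((p / 2 : ℝ) * (z - 1)))) := by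
      conv_lhs =>
        enter [2]
        rw [hf]
        enter [2]
        rw [hb2]
      rw [hb1, hRs, hR]
      simp only [Matrix.mul_assoc]
    simp only [hg]
    rw [hfac]
    refine (norm_trace_mul_le _ _).trans ?_
    have h1 := Real.sqrt_le_sqrt ((hsNormSq_mul_le_right _ _ hK3).trans
      (hsNormSq_mul_le_left _ R (norm_mul_le_one hK1 hK2)))
    have h2 := Real.sqrt_le_sqrt ((hsNormSq_mul_le_right _ _ hK2).trans
      (hsNormSq_conjTranspose R).le)
    refine (mul_le_mul h1 h2 (Real.sqrt_nonneg _) (Real.sqrt_nonneg _)).trans ?_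
    rw [Real.mul_self_sqrt (hsNormSq_nonneg _)]
  have hgp : g ((p⁻¹ : ℝ) : ℂ) = S := by
    have hpc : (p : ℂ) ≠ 0 := by exact_mod_cast hp0.ne'
    have hb' : b ((p⁻¹ : ℝ) : ℂ) = specFun hB.1 (suppPow (1 / 2 : ℝ)) := by
      simp only [hb]
      congr 2
      push_cast
      field_simp
      ring
    have hf' : specFun hF.1 (suppPow ((0 : ℝ) + p * ((p⁻¹ : ℝ) : ℂ))) = F := by
      conv_rhs => rw [← specFun_suppPow_one hF]
      congr 2
      push_cast
      field_simp
      ring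
    have hT : Uᴴ * specFun hB.1 (suppPow (1 / 2 : ℝ)) = Tᴴ := by
      conv_rhs => rw [← hUU]
      simp only [Matrix.conjTranspose_mul, specFun_suppPow_conjTranspose, RCLike.star_def,
        Complex.conj_ofReal]
    simp only [hg]
    rw [hb', hf', hUU, Matrix.mul_assoc _ Uᴴ, hT, hSC]
    have h := specFun_suppPow_mul hC.1 (p + (-p : ℝ) * ((p⁻¹ : ℝ) : ℂ)) 1
    rw [specFun_suppPow_one hC] at h
    rw [h]
    congr 3
    push_cast
    field_simp
    ring
  have hmain := hgE.norm_le_interp (t := p⁻¹) (inv_nonneg.2 hp0.le) (inv_le_one_of_one_le₀ hp)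
    hg0 hg1
  rw [hgp, Complex.norm_real, Real.norm_of_nonneg hS0] at hmain
  -- Interpolation gives `S ≤ S^(1-1/p) ‖R‖₂^(2/p)`; cancelling the power of `S` needs `S > 0`.
  rcases hS0.eq_or_lt with h0 | h0
  · rw [← h0]
    exact hsNormSq_nonneg _
  have hsp : S ^ (1 - p⁻¹) * S ^ p⁻¹ = S := by
    rw [← Real.rpow_add h0]
    simp
  have h4 : S ^ p⁻¹ ≤ hsNormSq R ^ p⁻¹ := by
    have : S ^ (1 - p⁻¹) * S ^ p⁻¹ ≤ S ^ (1 - p⁻¹) * hsNormSq R ^ p⁻¹ := by rwa [hsp]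
    exact le_of_mul_le_mul_left this (Real.rpow_pos_of_pos h0 _)
  exact (Real.rpow_le_rpow_iff hS0 (hsNormSq_nonneg _) (inv_pos.2 hp0)).1 h4

end ArakiLiebThirring

/-! ### Trace inequalities for positive matrices, and polynomial calculus. -/

section PositiveMatrices

variable {n : Type*} [Fintype n] [DecidableEq n] {A B : Matrix n n ℂ}

theorem absVal_of_posSemidef (hA : A.PosSemidef) : absVal A = A := by
  have hsa : IsSelfAdjoint A := hA.1
  have h1 : Aᴴ * A = cfc (fun x : ℝ => x * x) A := by
    rw [cfc_eq_specFun hA.1, hA.1.eq]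
    have h := specFun_mul hA.1 (fun x => (x : ℂ)) fun x => (x : ℂ)
    rw [specFun_id] at h
    simp only [h, Complex.ofReal_mul]
  rw [absVal, h1, ← cfc_comp' Real.sqrt (fun x : ℝ => x * x) A, cfc_eq_specFun hA.1]
  conv_rhs => rw [← specFun_id hA.1]
  refine specFun_congr _ fun i => ?_
  rw [Real.sqrt_mul_self (hA.eigenvalues_nonneg i)]

/-- The exponent `0` is excluded because the conventions differ on the kernel: `0 ^ 0 = 1` for real
powers, but `suppPow 0 0 = 0`. -/
theorem traceAbsPow_of_posSemidef (hA : A.PosSemidef) {r : ℝ} (hr : r ≠ 0) :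
    traceAbsPow r A = (specFun hA.1 (suppPow r)).trace.re := by
  rw [traceAbsPow, absVal_of_posSemidef hA, cfc_eq_specFun hA.1]
  congr 2
  exact specFun_congr _ fun i => (suppPow_ofReal (hA.eigenvalues_nonneg i) hr).symm

theorem ofReal_traceAbsPow (hA : A.PosSemidef) {r : ℝ} (hr : r ≠ 0) :
    (traceAbsPow r A : ℂ) = (specFun hA.1 (suppPow r)).trace := by
  rw [traceAbsPow_of_posSemidef hA hr, ← hsNormSq_specFun_suppPow hA.1 r, Complex.ofReal_re]

theorem traceAbsPow_nonneg (hA : A.PosSemidef) {r : ℝ} (hr : r ≠ 0) : 0 ≤ traceAbsPow r A := by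
  rw [traceAbsPow_of_posSemidef hA hr, ← hsNormSq_specFun_suppPow hA.1 r, Complex.ofReal_re]
  exact hsNormSq_nonneg _

/-- The convex function `t ^ p` lies above its tangent at `β`; for `β > 0` this is Bernoulli's
inequality at `α / β - 1`. -/
theorem rpow_tangent_le {α β p : ℝ} (hα : 0 ≤ α) (hβ : 0 ≤ β) (hp : 1 ≤ p) :
    β ^ p + p * (α - β) * β ^ (p - 1) ≤ α ^ p := by
  rcases hβ.eq_or_lt with rfl | hβ
  · rw [Real.zero_rpow (by linarith)]
    rcases hp.eq_or_lt with rfl | hp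
    · simp
    · rw [Real.zero_rpow (by linarith)]
      simpa using Real.rpow_nonneg hα p
  · have h := one_add_mul_self_le_rpow_one_add (s := α / β - 1)
      (by linarith [div_nonneg hα hβ.le]) hp
    rw [add_sub_cancel, Real.div_rpow hα hβ.le, le_div_iff₀ (Real.rpow_pos_of_pos hβ _)] at h
    refine le_trans (le_of_eq ?_) h
    have : β ^ p = β ^ (p - 1) * β := by
      rw [← Real.rpow_add_one hβ.ne']
      simp
    rw [this]
    field_simp

/-- The trace of `φ(A) ψ(B)` as a double sum over the two spectra. -/
theorem re_trace_specFun_mul_specFun (hA : A.IsHermitian) (hB : B.IsHermitian) (g g' : ℝ → ℝ) :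
    (specFun hA (fun x => (g x : ℂ)) * specFun hB fun x => (g' x : ℂ)).trace.re =
      ∑ i, ∑ j, g (hA.eigenvalues i) * g' (hB.eigenvalues j) *
        Complex.normSq (((hA.eigenvectorUnitary : Matrix n n ℂ)ᴴ *
          (hB.eigenvectorUnitary : Matrix n n ℂ)) i j) := by
  rw [trace_specFun_mul_specFun]
  norm_cast

/-- Klein's inequality for `x ^ p`, in the case where the first order term vanishes. -/
theorem traceAbsPow_le_of_trace_eq (hA : A.PosSemidef) (hB : B.PosSemidef) {p : ℝ} (hp : 1 ≤ p)
    (h : ∀ g : ℝ → ℂ, (A * specFun hB.1 g).trace = (B * specFun hB.1 g).trace) :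
    traceAbsPow p B ≤ traceAbsPow p A := by
  have hB' : traceAbsPow p B = (specFun hA.1 (fun x => ((1 : ℝ) : ℂ)) *
      specFun hB.1 fun x => ((x ^ p : ℝ) : ℂ)).trace.re := by
    rw [traceAbsPow, absVal_of_posSemidef hB, cfc_eq_specFun hB.1]
    simp [specFun_one]
  have hA' : traceAbsPow p A = (specFun hA.1 (fun x => ((x ^ p : ℝ) : ℂ)) *
      specFun hB.1 fun x => ((1 : ℝ) : ℂ)).trace.re := by
    rw [traceAbsPow, absVal_of_posSemidef hA, cfc_eq_specFun hA.1]
    simp [specFun_one]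
  have h1 := congrArg Complex.re (h fun x => ((x ^ (p - 1) : ℝ) : ℂ))
  have h2 : B * specFun hB.1 (fun x => ((x ^ (p - 1) : ℝ) : ℂ)) =
      specFun hA.1 (fun x => ((1 : ℝ) : ℂ)) *
        specFun hB.1 fun x => ((x * x ^ (p - 1) : ℝ) : ℂ) := by
    have := specFun_mul hB.1 (fun x => (x : ℂ)) fun x => ((x ^ (p - 1) : ℝ) : ℂ)
    rw [specFun_id] at this
    simp [this, specFun_one]
  have h3 : A * specFun hB.1 (fun x => ((x ^ (p - 1) : ℝ) : ℂ)) =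
      specFun hA.1 (fun x => ((id x : ℝ) : ℂ)) *
        specFun hB.1 fun x => ((x ^ (p - 1) : ℝ) : ℂ) := by
    simp only [id, specFun_id]
  rw [h2, h3, re_trace_specFun_mul_specFun, re_trace_specFun_mul_specFun] at h1
  rw [hA', hB', re_trace_specFun_mul_specFun, re_trace_specFun_mul_specFun]
  set W := (hA.1.eigenvectorUnitary : Matrix n n ℂ)ᴴ * (hB.1.eigenvectorUnitary : Matrix n n ℂ)
  -- The tangent inequality for each pair of eigenvalues, weighted by the overlap. After summation
  -- the first order part cancels by `h1`.
  have key : ∀ i j, 0 ≤ (hA.1.eigenvalues i ^ p * 1 * Complex.normSq (W i j) -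
      1 * hB.1.eigenvalues j ^ p * Complex.normSq (W i j)) -
      p * (id (hA.1.eigenvalues i) * hB.1.eigenvalues j ^ (p - 1) * Complex.normSq (W i j) -
      1 * (hB.1.eigenvalues j * hB.1.eigenvalues j ^ (p - 1)) * Complex.normSq (W i j)) := by
    intro i j
    have := mul_nonneg (sub_nonneg.2 (rpow_tangent_le (hA.eigenvalues_nonneg i)
      (hB.eigenvalues_nonneg j) hp)) (Complex.normSq_nonneg (W i j))
    simp only [id]
    linarith
  have := Finset.sum_nonneg fun i (_ : i ∈ Finset.univ) =>
    Finset.sum_nonneg fun j (_ : j ∈ Finset.univ) => key i j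
  have hsum : ∀ r : n → n → ℝ, ∑ i, ∑ j, p * r i j = p * ∑ i, ∑ j, r i j := fun r => by
    simp only [Finset.mul_sum]
  simp only [Finset.sum_sub_distrib, hsum] at this
  rw [h1] at this
  linarith

theorem eigenvalues_le_norm (hA : A.IsHermitian) (i : n) : hA.eigenvalues i ≤ ‖A‖ := by
  set U := (hA.eigenvectorUnitary : Matrix n n ℂ) with hU
  have h1 : Uᴴ * A * U = Matrix.diagonal fun i => (hA.eigenvalues i : ℂ) := by
    have h := specFun_id hA
    rw [specFun, ← hU] at h
    have hUU : Uᴴ * U = 1 := eigenvectorUnitary_star_mul_self hA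
    calc Uᴴ * A * U = (Uᴴ * U) * Matrix.diagonal (fun i => (hA.eigenvalues i : ℂ)) *
          (Uᴴ * U) := by
          conv_lhs => rw [← h]
          simp only [Matrix.mul_assoc]
      _ = _ := by rw [hUU, one_mul, mul_one]
  have hn := norm_le_one_of_star_mul_self (eigenvectorUnitary_star_mul_self hA)
  have hn' : ‖Uᴴ‖ ≤ 1 := by rwa [Matrix.l2_opNorm_conjTranspose]
  have h2 : ‖Uᴴ * A * U‖ ≤ ‖A‖ :=
    (Matrix.l2_opNorm_mul _ _).trans ((mul_le_of_le_one_right (norm_nonneg _) hn).trans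
      ((Matrix.l2_opNorm_mul _ _).trans (mul_le_of_le_one_left (norm_nonneg _) hn')))
  rw [h1, Matrix.l2_opNorm_diagonal] at h2
  refine le_trans ?_ h2
  refine le_trans ?_ (norm_le_pi_norm _ i)
  rw [Complex.norm_real]
  exact le_abs_self _

/-- For an eigenvalue `β` of `B` with spectral projection `P`, `β tr P = tr (B P) = tr (A P) ≤ ‖A‖
tr P`, and `tr P > 0`. -/
theorem norm_le_of_trace_eq (hA : A.PosSemidef) (hB : B.PosSemidef)
    (h : ∀ g : ℝ → ℂ, (A * specFun hB.1 g).trace = (B * specFun hB.1 g).trace) :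
    ‖B‖ ≤ ‖A‖ := by
  classical
  rw [← specFun_id hB.1]
  refine norm_specFun_le _ (norm_nonneg _) fun k => ?_
  rw [Complex.norm_real, Real.norm_of_nonneg (hB.eigenvalues_nonneg k)]
  set β := hB.1.eigenvalues k with hβ
  let φ : ℝ → ℝ := fun x => if x = β then 1 else 0
  have hφ : ∀ x, 0 ≤ φ x := fun x => by
    simp only [φ]
    split_ifs <;> simp
  have h1 := congrArg Complex.re (h fun x => (φ x : ℂ))
  have h2 : B * specFun hB.1 (fun x => (φ x : ℂ)) =
      (β : ℂ) • specFun hB.1 (fun x => (φ x : ℂ)) := by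
    have := specFun_mul hB.1 (fun x => (x : ℂ)) fun x => (φ x : ℂ)
    rw [specFun_id] at this
    rw [this, ← specFun_const_mul]
    refine specFun_congr _ fun i => ?_
    simp only [φ]
    split_ifs with hi
    · rw [hi]
    · simp
  have h3 : A * specFun hB.1 (fun x => (φ x : ℂ)) =
      specFun hA.1 (fun x => ((id x : ℝ) : ℂ)) * specFun hB.1 fun x => (φ x : ℂ) := by
    simp only [id, specFun_id]
  have h4 : specFun hB.1 (fun x => (φ x : ℂ)) =
      specFun hA.1 (fun x => ((1 : ℝ) : ℂ)) * specFun hB.1 fun x => (φ x : ℂ) := by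
    simp [specFun_one]
  have h5 : (specFun hB.1 (fun x => (φ x : ℂ))).trace.re = ∑ i, φ (hB.1.eigenvalues i) := by
    rw [trace_specFun]
    simp
  have h6 : 0 < ∑ i, φ (hB.1.eigenvalues i) :=
    Finset.sum_pos' (fun i _ => hφ _) ⟨k, Finset.mem_univ k, by simp [φ, hβ]⟩
  have h7 : (A * specFun hB.1 (fun x => (φ x : ℂ))).trace.re ≤
      ‖A‖ * (specFun hB.1 (fun x => (φ x : ℂ))).trace.re := by
    rw [h3]
    conv_rhs => rw [h4]
    rw [re_trace_specFun_mul_specFun, re_trace_specFun_mul_specFun, Finset.mul_sum]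
    refine Finset.sum_le_sum fun i _ => ?_
    rw [Finset.mul_sum]
    refine Finset.sum_le_sum fun j _ => ?_
    rw [one_mul, mul_assoc]
    exact mul_le_mul_of_nonneg_right (eigenvalues_le_norm hA.1 i)
      (mul_nonneg (hφ _) (Complex.normSq_nonneg _))
  rw [h1, h2, Matrix.trace_smul, smul_eq_mul, Complex.re_ofReal_mul, h5] at h7
  exact le_of_mul_le_mul_right h7 h6

/-- A function of two Hermitian matrices is given by a common polynomial. -/
theorem exists_polynomial_specFun_pair {m : Type*} [Fintype m] [DecidableEq m]
    {C : Matrix m m ℂ} (hA : A.IsHermitian) (hC : C.IsHermitian) (g : ℝ → ℂ) :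
    ∃ q : Polynomial ℂ, specFun hA g = aeval A q ∧ specFun hC g = aeval C q := by
  classical
  -- Lagrange interpolation at the union of both spectra makes one polynomial serve both matrices.
  let s : Finset ℂ := (Finset.univ.image fun i => (hA.eigenvalues i : ℂ)) ∪
    Finset.univ.image fun i => (hC.eigenvalues i : ℂ)
  have key : ∀ x : ℝ, (x : ℂ) ∈ s →
      g x = (Lagrange.interpolate s id fun z => g z.re).eval (x : ℂ) := fun x hx => by
    have h := Lagrange.eval_interpolate_at_node (s := s) (v := id) (fun z : ℂ => g z.re)
      Function.injective_id.injOn hx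
    simpa using h.symm
  refine ⟨Lagrange.interpolate s id fun z => g z.re, ?_, ?_⟩
  · rw [← specFun_polynomial hA]
    exact specFun_congr hA fun i => key _ (Finset.mem_union_left _
      (Finset.mem_image_of_mem _ (Finset.mem_univ i)))
  · rw [← specFun_polynomial hC]
    exact specFun_congr hC fun i => key _ (Finset.mem_union_right _
      (Finset.mem_image_of_mem _ (Finset.mem_univ i)))

end PositiveMatrices

/-! ### Row operators and the amplification `f ⊗ 1`. -/

section Amplification

variable {ι b e : Type*} [Fintype ι] [Fintype b] [Fintype e] [DecidableEq ι] [DecidableEq b]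
  [DecidableEq e]

/-- The row operator `(x₁, …, xₘ)`. -/
def rowOperator (x : ι → Matrix b e ℂ) : Matrix b (e × ι) ℂ :=
  Matrix.of fun i j => x j.2 i j.1

omit [Fintype b] [DecidableEq b] [DecidableEq e] in
theorem rowOperator_mul_blockDiagonal_mul (x : ι → Matrix b e ℂ) (f : Matrix e e ℂ) :
    rowOperator x * Matrix.blockDiagonal (fun _ : ι => f) * (rowOperator x)ᴴ =
      ∑ k, x k * f * (x k)ᴴ := by
  ext i j
  simp only [Matrix.mul_apply, Fintype.sum_prod_type, Matrix.sum_apply, rowOperator,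
    Matrix.of_apply, Matrix.conjTranspose_apply, Matrix.blockDiagonal_apply, mul_ite, mul_zero,
    Finset.sum_ite_eq', Finset.mem_univ, if_true]
  rw [Finset.sum_comm]

omit [Fintype b] [DecidableEq b] in
theorem rowOperator_mul_conjTranspose (x : ι → Matrix b e ℂ) :
    rowOperator x * (rowOperator x)ᴴ = ∑ k, x k * (x k)ᴴ := by
  have h := rowOperator_mul_blockDiagonal_mul x 1
  have h1 : Matrix.blockDiagonal (fun _ : ι => (1 : Matrix e e ℂ)) = 1 := Matrix.blockDiagonal_one
  simpa only [h1, Matrix.mul_one] using h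

theorem aeval_blockDiagonal (f : Matrix e e ℂ) (q : Polynomial ℂ) :
    aeval (Matrix.blockDiagonal fun _ : ι => f) q = Matrix.blockDiagonal fun _ => aeval f q := by
  induction q using Polynomial.induction_on' with
  | add p q hp hq =>
    simp only [map_add, hp, hq]
    rw [← Matrix.blockDiagonal_add]
    rfl
  | monomial k c =>
    rw [Polynomial.aeval_monomial, Polynomial.aeval_monomial, ← Algebra.smul_def,
      ← Algebra.smul_def, ← Matrix.blockDiagonal_pow, ← Matrix.blockDiagonal_smul]
    rfl

theorem posSemidef_blockDiagonal {f : Matrix e e ℂ} (hf : f.PosSemidef) :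
    (Matrix.blockDiagonal fun _ : ι => f).PosSemidef := by
  have h : Matrix.blockDiagonal (fun _ : ι => f) =
      Matrix.blockDiagonal (fun _ : ι => specFun hf.1 (suppPow (1 / 2 : ℝ))) *
        (Matrix.blockDiagonal fun _ : ι => specFun hf.1 (suppPow (1 / 2 : ℝ)))ᴴ := by
    rw [Matrix.blockDiagonal_conjTranspose, ← Matrix.blockDiagonal_mul]
    congr 1
    funext _
    rw [specFun_suppPow_conjTranspose, specFun_suppPow_mul]
    conv_lhs => rw [← specFun_suppPow_one hf]
    congr 2
    simp only [RCLike.star_def, Complex.conj_ofReal]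
    push_cast
    norm_num
  rw [h]
  exact Matrix.posSemidef_self_mul_conjTranspose _

theorem specFun_blockDiagonal {f : Matrix e e ℂ} (hf : f.IsHermitian)
    (hF : (Matrix.blockDiagonal fun _ : ι => f).IsHermitian) (g : ℝ → ℂ) :
    specFun hF g = Matrix.blockDiagonal fun _ => specFun hf g := by
  obtain ⟨q, h1, h2⟩ := exists_polynomial_specFun_pair hf hF g
  rw [h1, h2, aeval_blockDiagonal]

omit [DecidableEq ι] [DecidableEq b] [DecidableEq e] in
theorem posSemidef_sum_conj (x : ι → Matrix b e ℂ) {f : Matrix e e ℂ} (hf : f.PosSemidef) :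
    (∑ k, x k * f * (x k)ᴴ).PosSemidef :=
  Matrix.posSemidef_sum _ fun k _ => hf.mul_mul_conjTranspose_same (x k)

-- Conjugating `‖f‖ 1 - f ≥ 0` by each `x_k` and summing gives an operator inequality, and the norm
-- is monotone on positive operators.
omit [DecidableEq ι] in
open scoped MatrixOrder in
theorem norm_sum_conj_le (x : ι → Matrix b e ℂ) {f : Matrix e e ℂ} (hf : f.PosSemidef) :
    ‖∑ k, x k * f * (x k)ᴴ‖ ≤ ‖f‖ * ‖∑ k, x k * (x k)ᴴ‖ := by
  have h1 : (((‖f‖ : ℝ) : ℂ) • (1 : Matrix e e ℂ) - f).PosSemidef := by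
    have : ((‖f‖ : ℝ) : ℂ) • (1 : Matrix e e ℂ) - f =
        specFun hf.1 fun x => ((√(‖f‖ - x) : ℝ) : ℂ) * ((√(‖f‖ - x) : ℝ) : ℂ) := by
      have h2 : specFun hf.1 (fun x => ((‖f‖ : ℝ) : ℂ) * 1 + (-1) * (x : ℂ)) =
          ((‖f‖ : ℝ) : ℂ) • (1 : Matrix e e ℂ) - f := by
        rw [specFun_add, specFun_const_mul, specFun_const_mul, specFun_one, specFun_id]
        simp [sub_eq_add_neg]
      rw [← h2]
      refine specFun_congr _ fun i => ?_
      rw [← Complex.ofReal_mul, Real.mul_self_sqrt (sub_nonneg.2 (eigenvalues_le_norm hf.1 i))]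
      push_cast
      ring
    rw [this, ← specFun_mul]
    have h3 := specFun_conjTranspose hf.1 fun x => ((√(‖f‖ - x) : ℝ) : ℂ)
    simp only [RCLike.star_def, Complex.conj_ofReal] at h3
    nth_rewrite 2 [← h3]
    exact Matrix.posSemidef_self_mul_conjTranspose _
  have h2 := posSemidef_sum_conj x h1
  have h3 : ∑ k, x k * (((‖f‖ : ℝ) : ℂ) • (1 : Matrix e e ℂ) - f) * (x k)ᴴ =
      ((‖f‖ : ℝ) : ℂ) • (∑ k, x k * (x k)ᴴ) - ∑ k, x k * f * (x k)ᴴ := by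
    simp only [Matrix.mul_sub, Matrix.sub_mul, Finset.sum_sub_distrib, Matrix.mul_smul,
      Matrix.smul_mul, Matrix.mul_one, Finset.smul_sum]
  rw [h3] at h2
  have h4 := CStarAlgebra.norm_le_norm_of_nonneg_of_le
    (a := ∑ k, x k * f * (x k)ᴴ) (b := ((‖f‖ : ℝ) : ℂ) • (∑ k, x k * (x k)ᴴ))
    (Matrix.nonneg_iff_posSemidef.2 (posSemidef_sum_conj x hf)) (Matrix.le_iff.2 h2)
  rwa [norm_smul, Complex.norm_real, norm_norm] at h4

end Amplification

/-! ### Independence and the comparison inequalities over a TRO. -/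

section Comparison

variable {b e : Type*} [Fintype b] [Fintype e] [DecidableEq b] [DecidableEq e]
  {X : Submodule ℂ (Matrix b e ℂ)}

-- A function of `S` is a polynomial in `S`. The constant term is harmless because it acts on `y ∈
-- X` as a scalar.
omit [Fintype e] [DecidableEq e] in
theorem specFun_mul_mem {S : Matrix b b ℂ} (hS : S.IsHermitian)
    (hSX : ∀ y ∈ X, S * y ∈ X) (g : ℝ → ℂ) {y : Matrix b e ℂ} (hy : y ∈ X) :
    specFun hS g * y ∈ X := by
  obtain ⟨q, hq, -⟩ := exists_polynomial_specFun_pair hS hS g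
  rw [hq]
  clear hq
  induction q using Polynomial.induction_on' with
  | add p q hp hq =>
    rw [map_add, Matrix.add_mul]
    exact X.add_mem hp hq
  | monomial k c =>
    rw [Polynomial.aeval_monomial, ← Algebra.smul_def, Matrix.smul_mul]
    refine X.smul_mem _ ?_
    induction k with
    | zero => simpa using hy
    | succ k ih =>
      rw [pow_succ', Matrix.mul_assoc]
      exact hSX _ ih

omit [DecidableEq b] [DecidableEq e] in
theorem leftAlgebra_mul_mem (hX : IsTRO X) {S : Matrix b b ℂ} (hS : S ∈ leftAlgebra X)
    {y : Matrix b e ℂ} (hy : y ∈ X) : S * y ∈ X := by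
  induction hS using Submodule.span_induction with
  | mem s hs =>
    obtain ⟨u, hu, v, hv, rfl⟩ := hs
    exact hX u hu v hv y hy
  | zero => simp
  | add s t _ _ hs ht =>
    rw [Matrix.add_mul]
    exact X.add_mem hs ht
  | smul c s _ hs =>
    rw [Matrix.smul_mul]
    exact X.smul_mem _ hs

variable {f : Matrix e e ℂ}

/-- Strong independence is the case of monomials; linearity and interpolation extend it to all
functions, including the noninteger power `f ^ p`. -/
theorem normTrace_specFun_mul (hf : f.IsHermitian) {M : Submodule ℂ (Matrix e e ℂ)}
    (h : StronglyIndependent f M) (g : ℝ → ℂ) {y : Matrix e e ℂ} (hy : y ∈ M) :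
    normTrace (specFun hf g * y) = normTrace (specFun hf g) * normTrace y := by
  obtain ⟨q, hq, -⟩ := exists_polynomial_specFun_pair hf hf g
  rw [hq]
  clear hq
  induction q using Polynomial.induction_on' with
  | add p q hp hq =>
    unfold normTrace at hp hq ⊢
    rw [map_add, Matrix.add_mul, Matrix.trace_add, Matrix.trace_add, add_div, add_div, hp, hq,
      add_mul]
  | monomial k c =>
    have := h k y hy
    unfold normTrace at this ⊢
    rw [Polynomial.aeval_monomial, ← Algebra.smul_def, Matrix.smul_mul, Matrix.trace_smul,
      Matrix.trace_smul, smul_eq_mul, smul_eq_mul, mul_div_assoc, mul_div_assoc, this, mul_assoc]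

omit [DecidableEq b] in
theorem trace_mul_specFun_mul (hf : f.IsHermitian) (h1 : normTrace f = 1)
    (h : StronglyIndependent f (rightAlgebra X)) (g : ℝ → ℂ) {x y : Matrix b e ℂ}
    (hx : x ∈ X) (hy : y ∈ X) :
    (x * specFun hf g * yᴴ).trace = normTrace (specFun hf g) * (x * yᴴ).trace := by
  -- `τ(f) = 1` excludes `H_E = 0`, where division by the dimension would return `0`.
  have hc : (Fintype.card e : ℂ) ≠ 0 := by
    intro h0
    simp [normTrace, h0] at h1
  have h2 := normTrace_specFun_mul hf h g
    (Submodule.subset_span ⟨y, hy, x, hx, rfl⟩ : yᴴ * x ∈ rightAlgebra X)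
  rw [Matrix.mul_assoc, Matrix.trace_mul_comm, Matrix.mul_assoc, Matrix.trace_mul_comm x]
  rw [normTrace, normTrace.eq_def (yᴴ * x), ← mul_div_assoc, div_left_inj' hc] at h2
  exact h2

variable {ι : Type*} [Fintype ι]

omit [DecidableEq b] [DecidableEq e] in
theorem sum_mul_conjTranspose_mul_mem (hX : IsTRO X) {x : ι → Matrix b e ℂ} (hx : ∀ k, x k ∈ X)
    {y : Matrix b e ℂ} (hy : y ∈ X) : (∑ k, x k * (x k)ᴴ) * y ∈ X := by
  rw [Matrix.sum_mul]
  exact X.sum_mem fun k _ => hX _ (hx k) _ (hx k) _ hy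

omit [DecidableEq b] [DecidableEq e] in
theorem posSemidef_sum_mul_conjTranspose (x : ι → Matrix b e ℂ) :
    (∑ k, x k * (x k)ᴴ).PosSemidef :=
  Matrix.posSemidef_sum _ fun _ _ => Matrix.posSemidef_self_mul_conjTranspose _

/-- The conditional expectation onto the left algebra sends `∑ xₖ f xₖ*` to `∑ xₖ xₖ*`. -/
theorem trace_sum_mul_specFun (hX : IsTRO X) (hf : f.PosSemidef) (h1 : normTrace f = 1)
    (h : StronglyIndependent f (rightAlgebra X)) {x : ι → Matrix b e ℂ} (hx : ∀ k, x k ∈ X)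
    (hB : (∑ k, x k * (x k)ᴴ).IsHermitian) (g : ℝ → ℂ) :
    ((∑ k, x k * f * (x k)ᴴ) * specFun hB g).trace =
      ((∑ k, x k * (x k)ᴴ) * specFun hB g).trace := by
  rw [Matrix.sum_mul, Matrix.sum_mul, Matrix.trace_sum, Matrix.trace_sum]
  refine Finset.sum_congr rfl fun k _ => ?_
  have hm := specFun_mul_mem hB (fun y hy => sum_mul_conjTranspose_mul_mem hX hx hy) g (hx k)
  have h2 := trace_mul_specFun_mul hf.1 h1 h (fun x => (x : ℂ)) hm (hx k)
  rw [specFun_id, h1, one_mul] at h2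
  rw [Matrix.trace_mul_comm, Matrix.trace_mul_comm _ (specFun hB g)]
  simpa only [Matrix.mul_assoc] using h2

/-- The Araki-Lieb-Thirring bound moves the power onto `f` and leaves weights `w` that are functions
of `B`. These keep `x_k` inside `X`, so independence pulls out `τ(f^p)`. -/
theorem traceAbsPow_sum_le (hX : IsTRO X) (hf : f.PosSemidef) (h1 : normTrace f = 1)
    (h : StronglyIndependent f (rightAlgebra X)) {x : ι → Matrix b e ℂ} (hx : ∀ k, x k ∈ X)
    {p : ℝ} (hp : 1 ≤ p) :
    traceAbsPow p (∑ k, x k * f * (x k)ᴴ) ≤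
      traceAbsPow p f / (Fintype.card e : ℝ) * traceAbsPow p (∑ k, x k * (x k)ᴴ) := by
  classical
  have hp0 : p ≠ 0 := by linarith
  have hF := posSemidef_blockDiagonal (ι := ι) hf
  have hBx := posSemidef_sum_mul_conjTranspose x
  have hCx := posSemidef_sum_conj x hf
  have hTB := rowOperator_mul_conjTranspose x
  have hTC := rowOperator_mul_blockDiagonal_mul x f
  have hB := hTB ▸ hBx
  have hC := hTC ▸ hCx
  have key := trace_rpow_le_of_one_le hF hB hC hp
  rw [← traceAbsPow_of_posSemidef hC hp0, hTC] at key
  refine key.trans (le_of_eq ?_)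
  rw [← Complex.ofReal_inj, ofReal_hsNormSq]
  simp only [specFun_blockDiagonal hf.1]
  -- The calculus carries a proof that its matrix is Hermitian, so the two forms of `T T*` are
  -- identified by substitution.
  have hw : ∀ (B : Matrix b b ℂ) (hB : B.PosSemidef), B = ∑ k, x k * (x k)ᴴ →
      specFun hB.1 (suppPow ((p - 1) / 2 : ℝ)) = specFun hBx.1 (suppPow ((p - 1) / 2 : ℝ)) := by
    rintro _ _ rfl
    rfl
  rw [hw _ hB hTB]
  set w := specFun hBx.1 (suppPow ((p - 1) / 2 : ℝ)) with hwdef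
  set d := specFun hf.1 (suppPow (p / 2 : ℝ)) with hd
  have hws : wᴴ = w := by
    rw [hwdef, specFun_suppPow_conjTranspose]
    simp
  have hdd : d * dᴴ = specFun hf.1 (suppPow p) := by
    rw [hd, specFun_suppPow_conjTranspose, specFun_suppPow_mul]
    congr 2
    simp only [RCLike.star_def, Complex.conj_ofReal]
    push_cast
    ring
  have hexp : w * rowOperator x * Matrix.blockDiagonal (fun _ : ι => d) *
      (w * rowOperator x * Matrix.blockDiagonal (fun _ : ι => d))ᴴ =
      ∑ k, (w * x k) * specFun hf.1 (suppPow p) * (w * x k)ᴴ := by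
    have h2 : w * rowOperator x * Matrix.blockDiagonal (fun _ : ι => d) *
      (w * rowOperator x * Matrix.blockDiagonal (fun _ : ι => d))ᴴ =
        w * (rowOperator x * Matrix.blockDiagonal (fun _ : ι => d * dᴴ) * (rowOperator x)ᴴ) *
          wᴴ := by
      rw [Matrix.blockDiagonal_mul, Matrix.conjTranspose_mul, Matrix.conjTranspose_mul,
        ← Matrix.blockDiagonal_conjTranspose]
      simp only [Matrix.mul_assoc]
    rw [h2, hdd, rowOperator_mul_blockDiagonal_mul, Matrix.mul_sum, Matrix.sum_mul]
    simp only [Matrix.conjTranspose_mul, Matrix.mul_assoc]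
  have hwx : ∀ k, w * x k ∈ X := fun k =>
    specFun_mul_mem hBx.1 (fun y hy => sum_mul_conjTranspose_mul_mem hX hx hy) _ (hx k)
  have hsum : ∑ k, ((w * x k) * (w * x k)ᴴ).trace = (traceAbsPow p (∑ k, x k * (x k)ᴴ) : ℂ) := by
    rw [ofReal_traceAbsPow hBx hp0, ← Matrix.trace_sum]
    have h3 : ∑ k, (w * x k) * (w * x k)ᴴ = w * (∑ k, x k * (x k)ᴴ) * w := by
      rw [Matrix.mul_sum, Matrix.sum_mul]
      simp only [Matrix.conjTranspose_mul, hws, Matrix.mul_assoc]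
    have h4 : w * specFun hBx.1 (suppPow 1) * w = specFun hBx.1 (suppPow p) := by
      rw [hwdef, specFun_suppPow_mul, specFun_suppPow_mul]
      congr 2
      push_cast
      ring
    rw [h3, ← h4, specFun_suppPow_one hBx]
  rw [hexp, Matrix.trace_sum]
  simp only [trace_mul_specFun_mul hf.1 h1 h (suppPow p) (hwx _) (hwx _)]
  rw [← Finset.mul_sum, hsum, normTrace, ← ofReal_traceAbsPow hf hp0]
  push_cast
  rfl

/-- The local comparison property for `∑ xₖ xₖ*` and `∑ xₖ f xₖ*` with `xₖ` in a ternary ring of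
operators. -/
theorem schattenNorm_sum_comparison (hX : IsTRO X) (hf : f.PosSemidef) (h1 : normTrace f = 1)
    (h : StronglyIndependent f (rightAlgebra X)) {x : ι → Matrix b e ℂ} (hx : ∀ k, x k ∈ X)
    {p : ℝ≥0∞} (hp : 1 ≤ p) :
    schattenNorm p (∑ k, x k * (x k)ᴴ) ≤ schattenNorm p (∑ k, x k * f * (x k)ᴴ) ∧
      schattenNorm p (∑ k, x k * f * (x k)ᴴ) ≤
        normalizedLpNorm p f * schattenNorm p (∑ k, x k * (x k)ᴴ) := by
  have hB := posSemidef_sum_mul_conjTranspose x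
  have hC := posSemidef_sum_conj x hf
  have htr := trace_sum_mul_specFun hX hf h1 h hx hB.1
  unfold schattenNorm normalizedLpNorm
  by_cases hpt : p = ∞
  · simp only [if_pos hpt]
    exact ⟨norm_le_of_trace_eq hC hB htr, norm_sum_conj_le x hf⟩
  · simp only [if_neg hpt]
    have hr : 1 ≤ p.toReal := by
      rw [← ENNReal.toReal_one]
      exact ENNReal.toReal_mono hpt hp
    have hr0 : p.toReal ≠ 0 := by linarith
    have hinv : 0 ≤ 1 / p.toReal := by positivity
    refine ⟨Real.rpow_le_rpow (traceAbsPow_nonneg hB hr0)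
      (traceAbsPow_le_of_trace_eq hC hB hr htr) hinv, ?_⟩
    rw [← Real.mul_rpow (div_nonneg (traceAbsPow_nonneg hf hr0) (Nat.cast_nonneg _))
      (traceAbsPow_nonneg hB hr0)]
    exact Real.rpow_le_rpow (traceAbsPow_nonneg hC hr0) (traceAbsPow_sum_le hX hf h1 h hx hr) hinv

end Comparison

end TROChannel

/-- Local comparison property of TRO channels. -/
theorem theorem2p4 {a b e : Type*} [Fintype a] [Fintype b] [Fintype e]
    [DecidableEq a] [DecidableEq b] [DecidableEq e]
    (N : Matrix a a ℂ →ₗ[ℂ] Matrix b b ℂ) (V : Matrix (b × e) a ℂ)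
    (hN : TROChannel.IsTROChannel N V)
    (f : Matrix e e ℂ) (hf : TROChannel.IsSymbol V f)
    (p p' : ℝ≥0∞) (hp : 1 ≤ p) (hpp' : 1 / p + 1 / p' = 1)
    (σ : Matrix b b ℂ) (hσ : σ.PosSemidef)
    (hσL : σ ∈ TROChannel.leftAlgebra (TROChannel.stinespringSpace V))
    (ρ : Matrix a a ℂ) (hρ : ρ.PosSemidef) :
    (TROChannel.schattenNorm p (N ρ) ≤
        TROChannel.schattenNorm p (TROChannel.modified V f ρ) ∧
      TROChannel.schattenNorm p (TROChannel.modified V f ρ) ≤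
        TROChannel.normalizedLpNorm p f * TROChannel.schattenNorm p (N ρ)) ∧
    (TROChannel.schattenNorm p
        (TROChannel.negPow σ (1 / (2 * p')).toReal * N ρ *
          TROChannel.negPow σ (1 / (2 * p')).toReal) ≤
        TROChannel.schattenNorm p
        (TROChannel.negPow σ (1 / (2 * p')).toReal * TROChannel.modified V f ρ *
          TROChannel.negPow σ (1 / (2 * p')).toReal) ∧
      TROChannel.schattenNorm p
        (TROChannel.negPow σ (1 / (2 * p')).toReal * TROChannel.modified V f ρ *
          TROChannel.negPow σ (1 / (2 * p')).toReal) ≤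
        TROChannel.normalizedLpNorm p f *
          TROChannel.schattenNorm p
            (TROChannel.negPow σ (1 / (2 * p')).toReal * N ρ *
              TROChannel.negPow σ (1 / (2 * p')).toReal)) := by
  -- Positivity of `ρ` enters here: only a sum of `|v⟩⟨v|` gives outputs of the form `∑ x f x*`.
  obtain ⟨m, v, rfl⟩ := Matrix.posSemidef_iff_eq_sum_vecMulVec.1 hρ
  set x := fun k => TROChannel.toOperator V (v k) with hx
  have hxX : ∀ k, x k ∈ TROChannel.stinespringSpace V := fun k => LinearMap.mem_range_self _ _
  have hNf : ∀ g, TROChannel.modified V g (∑ k, Matrix.vecMulVec (v k) (star (v k))) =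
      ∑ k, x k * g * (x k)ᴴ := fun g => by
    rw [map_sum]
    simp only [TROChannel.modified_rankOne, hx]
  have hN1 : N (∑ k, Matrix.vecMulVec (v k) (star (v k))) = ∑ k, x k * (x k)ᴴ := by
    rw [← TROChannel.modified_one hN.toIsStinespringDilation, hNf]
    simp only [Matrix.mul_one]
  rw [hNf, hN1]
  refine ⟨TROChannel.schattenNorm_sum_comparison hN.isTRO hf.pos hf.normalized
    hf.stronglyIndependent hxX hp, ?_⟩
  -- For `p' = ∞` the exponent is `0`, and `s` is the support projection of `σ`. In every case `s`
  -- is a real function of `σ`, hence self-adjoint and mapping `X` into `X`.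
  set s := TROChannel.negPow σ (1 / (2 * p')).toReal with hs
  have hse : s = _ := TROChannel.cfc_eq_specFun hσ.1 _
  have hss : sᴴ = s := by
    rw [hse, TROChannel.specFun_conjTranspose]
    simp only [RCLike.star_def, Complex.conj_ofReal]
  have hsx : ∀ k, s * x k ∈ TROChannel.stinespringSpace V := fun k => by
    rw [hse]
    exact TROChannel.specFun_mul_mem hσ.1
      (fun y hy => TROChannel.leftAlgebra_mul_mem hN.isTRO hσL hy) _ (hxX k)
  have hsum : ∀ g : Matrix e e ℂ, s * (∑ k, x k * g * (x k)ᴴ) * s = ∑ k, (s * x k) * g * (s * x k)ᴴ := by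
    intro g
    rw [Matrix.mul_sum, Matrix.sum_mul]
    simp only [Matrix.conjTranspose_mul, hss, Matrix.mul_assoc]
  have hsum1 : s * (∑ k, x k * (x k)ᴴ) * s = ∑ k, (s * x k) * (s * x k)ᴴ := by
    simpa only [Matrix.mul_one] using hsum 1
  rw [hsum, hsum1]
  exact TROChannel.schattenNorm_sum_comparison hN.isTRO hf.pos hf.normalized
    hf.stronglyIndependent hsx hp
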